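/- Let $G$ be an almost simple complex linear algebraic group, $T\subset B\subset G$ a maximal torus and a Borel subgroup, $W=N_G(T)/T$ the Weyl group, and $\mathcal{C}\subset G$ a conjugacy class. Let $B_W^+$ be the positive braid monoid: it is generated by the positive lifts $\widetilde{w}$ of the elements $w\in W$, with relations $\widetilde{1}=1$ and $\widetilde{u}\,\widetilde{v}=\widetilde{uv}$ whenever $\ell(uv)=\ell(u)+\ell(v)$. For flags $F,F'\in G/B$ write $w(F,F')=w$ if $(F,F')$ lies in the $G$-orbit of $(B,wB)$. Let $\beta=\widetilde{w_1}\cdots\widetilde{w_n}\in B_W^+$ be a positive braid, where $n\ge 1$ and $w_1,\dots,w_n\in W$. Define the braid stack $$\mathcal{M}(\beta,\mathcal{C}):=\Big\{(g,F_1,\dots,F_{n+1})\in\mathcal{C}\times(G/B)^{n+1}\ \Big|\ gF_1=F_{n+1},\ w(F_i,F_{i+1})=w_i\text{ for } i=1,\dots,n\Big\}\Big/G,$$ where $a\in G$ acts by $a\cdot(g,F_1,\dots,F_{n+1})=(aga^{-1},aF_1,\dots,aF_{n+1})$ and the quotient is the quotient stack, considered through its groupoid of complex points; and define $$B(\beta):=\prod_{i=1}^n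 (Bw_iB)\subseteq G.$$ Then $\mathcal{M}(\beta,\mathcal{C})\neq\emptyset$ if and only if $B(\beta)\cap\mathcal{C}\neq\emptyset$. -/

import Mathlib

open scoped Pointwise Topology

noncomputable section

namespace BraidStacks

/-! ### Linear algebraic groups over `ℂ`, identified with their groups of complex points -/

/-- The Zariski topology on `GL_r(ℂ)`: the basic open sets are the non-vanishing loci of
polynomials in the matrix entries. -/
abbrev zariskiGL (r : ℕ) : TopologicalSpace (GL (Fin r) ℂ) :=
  TopologicalSpace.generateFrom
    {U | ∃ p : MvPolynomial (Fin r × Fin r) ℂ,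
      U = {g : GL (Fin r) ℂ |
        MvPolynomial.eval (fun ij => (g : Matrix (Fin r) (Fin r) ℂ) ij.1 ij.2) p ≠ 0}}

variable {r : ℕ}

/-- The Zariski topology on a subgroup `G` of `GL_r(ℂ)`. -/
abbrev zariski (G : Subgroup (GL (Fin r) ℂ)) : TopologicalSpace G :=
  (zariskiGL r).induced Subtype.val

/-- `G` is a linear algebraic group: a Zariski closed subgroup of `GL_r(ℂ)`. -/
def IsLinearAlgebraic (G : Subgroup (GL (Fin r) ℂ)) : Prop :=
  IsClosed[zariskiGL r] (G : Set (GL (Fin r) ℂ))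

variable {G : Subgroup (GL (Fin r) ℂ)}

/-- `H` is a closed connected subgroup of `G` (for the Zariski topology). -/
structure IsClosedConnected (H : Subgroup G) : Prop where
  isClosed : IsClosed[zariski G] (H : Set G)
  isConnected : @IsConnected G (zariski G) (H : Set G)

/-- `G` is an almost simple linear algebraic group: closed in `GL_r(ℂ)`, connected,
non-commutative, with no closed connected normal subgroups besides `1` and `G`. -/
structure IsAlmostSimple (G : Subgroup (GL (Fin r) ℂ)) : Prop where
  isLinearAlgebraic : IsLinearAlgebraic G
  isClosedConnected : IsClosedConnected (⊤ : Subgroup G)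
  noncommutative : ∃ g h : G, g * h ≠ h * g
  normal_eq : ∀ N : Subgroup G, N.Normal → IsClosedConnected N → N = ⊥ ∨ N = ⊤

/-- A Borel subgroup: a maximal closed connected solvable subgroup. -/
def IsBorel (B : Subgroup G) : Prop :=
  Maximal (fun H : Subgroup G => IsClosedConnected H ∧ Group.IsSolvable H) B

/-- A torus: a closed connected subgroup that can be conjugated, in `GL_r(ℂ)`, into the group of
diagonal matrices. -/
def IsTorus (T : Subgroup G) : Prop :=
  IsClosedConnected T ∧ ∃ P : GL (Fin r) ℂ, ∀ t ∈ T,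
    ((P * (t : GL (Fin r) ℂ) * P⁻¹ : GL (Fin r) ℂ) : Matrix (Fin r) (Fin r) ℂ).IsDiag

/-- A maximal torus of `G`. -/
def IsMaximalTorus (T : Subgroup G) : Prop :=
  Maximal (fun H : Subgroup G => IsTorus H) T

/-! ### The Weyl group, Bruhat double cosets and the positive braid monoid -/

/-- The Weyl group `W = N_G(T) / T`. -/
abbrev Weyl (T : Subgroup G) : Type :=
  Subgroup.normalizer (T : Set G) ⧸ T.subgroupOf (Subgroup.normalizer (T : Set G))

/-- `g ∈ G` is a lift of `w ∈ W`: it lies in `N_G(T)` and its class modulo `T` is `w`. -/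
def IsLift {T : Subgroup G} (w : Weyl T) (g : G) : Prop :=
  ∃ h : g ∈ Subgroup.normalizer (T : Set G),
    QuotientGroup.mk (⟨g, h⟩ : Subgroup.normalizer (T : Set G)) = w

/-- The Bruhat double coset `BwB`. -/
def bruhatCell (B : Subgroup G) {T : Subgroup G} (w : Weyl T) : Set G :=
  {g | ∃ x : G, IsLift w x ∧ g ∈ DoubleCoset.doubleCoset x (B : Set G) (B : Set G)}

/-- The simple reflections of `W` determined by `B`: the elements `s ≠ 1` for which `B ∪ BsB` is
a subgroup (that is, a minimal parabolic subgroup containing `B` properly). -/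
def simpleReflections (B T : Subgroup G) : Set (Weyl T) :=
  {s | s ≠ 1 ∧ ∃ P : Subgroup G, (P : Set G) = (B : Set G) ∪ bruhatCell B s}

/-- The length of `w ∈ W` with respect to the simple reflections. -/
def length (B : Subgroup G) {T : Subgroup G} (w : Weyl T) : ℕ :=
  sInf {k | ∃ l : List (Weyl T), (∀ s ∈ l, s ∈ simpleReflections B T) ∧ l.prod = w ∧ l.length = k}

/-- The defining relations of the positive braid monoid on the generators `w̃`, `w ∈ W`:
`1̃ = 1`, and `ũ ṽ = (uv)~` whenever `ℓ(uv) = ℓ(u) + ℓ(v)`. -/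
inductive BraidRel (B T : Subgroup G) : FreeMonoid (Weyl T) → FreeMonoid (Weyl T) → Prop
  | one : BraidRel B T (FreeMonoid.of 1) 1
  | mul (u v : Weyl T) (h : length B (u * v) = length B u + length B v) :
      BraidRel B T (FreeMonoid.of u * FreeMonoid.of v) (FreeMonoid.of (u * v))

/-- The positive braid monoid `B_W^+`. -/
abbrev BraidMonoid (B T : Subgroup G) : Type := PresentedMonoid (BraidRel B T)

/-- The positive lift `w̃ ∈ B_W^+` of `w ∈ W`. -/
def positiveLift (B : Subgroup G) {T : Subgroup G} (w : Weyl T) : BraidMonoid B T :=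
  PresentedMonoid.of (BraidRel B T) w

/-- An expression `β = w̃₁ ⋯ w̃ₙ` of a positive braid as a product of positive lifts. -/
structure BraidExpression {B T : Subgroup G} (β : BraidMonoid B T) where
  n : ℕ
  w : Fin n → Weyl T
  eq_prod : β = (List.ofFn fun i => positiveLift B (w i)).prod

/-! ### Flags and the braid stack -/

/-- The flag variety of `G`. -/
abbrev Flag (B : Subgroup G) : Type := G ⧸ B

/-- The flags `F`, `F'` are in relative position `w`: the pair `(F, F')` lies in the `G`-orbit of
`(B, wB)`. -/
def RelPos {B T : Subgroup G} (F F' : Flag B) (w : Weyl T) : Prop :=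
  ∃ g x : G, IsLift w x ∧ F = g • (QuotientGroup.mk 1 : Flag B) ∧
    F' = g • (QuotientGroup.mk x : Flag B)

/-- The set of tuples `(g, F₁, …, Fₙ₊₁) ∈ C × (G/B)ⁿ⁺¹` with `g F₁ = Fₙ₊₁` and
`w(Fᵢ, Fᵢ₊₁) = wᵢ` for `i = 1, …, n`. -/
@[ext]
structure BraidSpace {B T : Subgroup G} {β : BraidMonoid B T} (e : BraidExpression β)
    (C : ConjClasses G) where
  g : G
  F : Fin (e.n + 1) → Flag B
  mem : g ∈ C.carrier
  smul_eq : g • F 0 = F (Fin.last e.n)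
  relPos : ∀ i : Fin e.n, RelPos (F i.castSucc) (F i.succ) (e.w i)

theorem RelPos.smul {B T : Subgroup G} {F F' : Flag B} {w : Weyl T} (a : G) (h : RelPos F F' w) :
    RelPos (a • F) (a • F') w := by
  obtain ⟨g, x, hx, rfl, rfl⟩ := h
  exact ⟨a * g, x, hx, by rw [mul_smul], by rw [mul_smul]⟩

/-- `G` acts by `a • (g, F₁, …, Fₙ₊₁) = (a g a⁻¹, a F₁, …, a Fₙ₊₁)`. -/
instance {B T : Subgroup G} {β : BraidMonoid B T} (e : BraidExpression β) (C : ConjClasses G) :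
    MulAction G (BraidSpace e C) where
  smul a p :=
    { g := a * p.g * a⁻¹
      F := fun i => a • p.F i
      mem := by
        have h := p.mem
        rw [ConjClasses.mem_carrier_iff_mk_eq] at h ⊢
        exact (ConjClasses.mk_eq_mk_iff_isConj.2 (isConj_iff.2 ⟨a, rfl⟩).symm).trans h
      smul_eq := by
        rw [← p.smul_eq, smul_smul, smul_smul, inv_mul_cancel_right]
      relPos := fun i => (p.relPos i).smul a }
  one_smul p := by
    apply BraidSpace.ext
    · change 1 * p.g * 1⁻¹ = p.g
      simp
    · funext i
      exact one_smul G (p.F i)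
  mul_smul a b p := by
    apply BraidSpace.ext
    · change a * b * p.g * (a * b)⁻¹ = a * (b * p.g * b⁻¹) * a⁻¹
      group
    · funext i
      exact mul_smul a b (p.F i)

/-- The braid stack `M(β, C)`, through its groupoid of complex points: the quotient groupoid of
the set of tuples by the action of `G`. -/
abbrev BraidStack {B T : Subgroup G} {β : BraidMonoid B T} (e : BraidExpression β)
    (C : ConjClasses G) : Type :=
  CategoryTheory.ActionCategory G (BraidSpace e C)

/-- The product `B(β) = (Bw₁B) ⋯ (BwₙB) ⊆ G`. -/
def cellProduct {B T : Subgroup G} {β : BraidMonoid B T} (e : BraidExpression β) : Set G :=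
  (List.ofFn fun i => bruhatCell B (e.w i)).prod

end BraidStacks

end

namespace BraidStacks

/-! Write the flags as cosets `F i = k i B`. Relative position then says that each quotient `(k i)⁻¹
* k (i+1)` lies in a Bruhat cell, and these quotients telescope to `(k 0)⁻¹ * k n`, an element of
`B(β)`. Choosing `k n = g * k 0`, as `g F₁ = Fₙ₊₁` permits, turns this element into a conjugate of
`g`. Conversely, the partial products of a factorization of `h ∈ B(β) ∩ C` give a chain of flags
from `B` to `hB`. -/

/-- The flags `aB`, `bB` are in relative position `w` exactly when `a⁻¹b ∈ BwB`. -/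
theorem relPos_mk_iff {r : ℕ} {G : Subgroup (GL (Fin r) ℂ)} {B T : Subgroup G} (a b : G)
    (w : Weyl T) :
    RelPos (QuotientGroup.mk a : Flag B) (QuotientGroup.mk b) w ↔
      a⁻¹ * b ∈ bruhatCell B w := by
  constructor
  · rintro ⟨g, x, hx, ha, hb⟩
    refine ⟨x, hx, DoubleCoset.mem_doubleCoset.2 ?_⟩
    rw [MulAction.Quotient.smul_mk, smul_eq_mul, mul_one, QuotientGroup.eq] at ha
    rw [MulAction.Quotient.smul_mk, smul_eq_mul, eq_comm, QuotientGroup.eq] at hb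
    exact ⟨a⁻¹ * g, ha, (g * x)⁻¹ * b, hb, by group⟩
  · rintro ⟨x, hx, h⟩
    obtain ⟨c, hc, d, hd, h⟩ := DoubleCoset.mem_doubleCoset.1 h
    -- With `a⁻¹b = cxd` and `c, d ∈ B`: `acB = aB` and `acxB = bd⁻¹B = bB`.
    refine ⟨a * c, x, hx, ?_, ?_⟩
    · rw [MulAction.Quotient.smul_mk, smul_eq_mul, mul_one, QuotientGroup.eq]
      simpa using hc
    · rw [MulAction.Quotient.smul_mk, smul_eq_mul, eq_comm, QuotientGroup.eq]
      rwa [mul_assoc a, mul_inv_rev, mul_assoc, h, inv_mul_cancel_left]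

/-- The endpoints of a chain of group elements with successive quotients in the Bruhat cells
`Bwᵢ B` differ by an element of `B(β)`, and every element of `B(β)` arises in this way. -/
theorem mem_cellProduct_iff {r : ℕ} {G : Subgroup (GL (Fin r) ℂ)} {B T : Subgroup G}
    {β : BraidMonoid B T} (e : BraidExpression β) (h : G) :
    h ∈ cellProduct e ↔ ∃ f : Fin (e.n + 1) → G, (f 0)⁻¹ * f (Fin.last e.n) = h ∧
      ∀ i : Fin e.n, (f i.castSucc)⁻¹ * f i.succ ∈ bruhatCell B (e.w i) := by
  have last (u : Fin e.n → G) : Fin.partialProd u (Fin.last e.n) = (List.ofFn u).prod := by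
    rw [Fin.partialProd, Fin.val_last, List.take_of_length_le (by simp)]
  rw [cellProduct, Set.mem_prod_list_ofFn]
  constructor
  · rintro ⟨u, rfl⟩
    refine ⟨Fin.partialProd fun i => (u i : G), ?_, fun i => ?_⟩
    · rw [last, Fin.partialProd_zero, inv_one, one_mul]
    · rw [Fin.partialProd_right_inv]
      exact (u i).2
  · rintro ⟨f, rfl, hf⟩
    refine ⟨fun i => ⟨_, hf i⟩, ?_⟩
    rw [← last, eq_inv_mul_iff_mul_eq]
    exact congrFun (Fin.partialProd_left_inv f) (Fin.last e.n)

/-- A point of the braid space yields a conjugate of its group element in `B(β)`. -/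
theorem BraidSpace.exists_conj_mem_cellProduct {r : ℕ} {G : Subgroup (GL (Fin r) ℂ)}
    {B T : Subgroup G} {β : BraidMonoid B T} {e : BraidExpression β} {C : ConjClasses G}
    (hn : 0 < e.n) (p : BraidSpace e C) : ∃ a : G, a⁻¹ * p.g * a ∈ cellProduct e := by
  choose f hf using fun i => QuotientGroup.mk_surjective (p.F i)
  -- Here `n ≥ 1` is essential: changing the last representative must not change the first. For `n =
  -- 0` one only gets a conjugate of `g` in `B`, whereas the empty product is `{1}`.
  have h0 : (0 : Fin (e.n + 1)) ≠ Fin.last e.n := by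
    simp [Fin.ext_iff, hn.ne]
  -- representatives of the flags, with the last one adjusted to `g` times the first one
  let k : Fin (e.n + 1) → G := Function.update f (Fin.last e.n) (p.g * f 0)
  have hk (i) : (QuotientGroup.mk (k i) : Flag B) = p.F i := by
    by_cases hi : i = Fin.last e.n
    · subst hi
      rw [← p.smul_eq, ← hf 0, MulAction.Quotient.smul_mk]
      simp [k]
    · simp [k, hi, hf]
  refine ⟨f 0, (mem_cellProduct_iff e _).2 ⟨k, ?_, fun i => ?_⟩⟩
  · simp [k, h0, mul_assoc]
  · rw [← relPos_mk_iff, hk, hk]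
    exact p.relPos i

/-- An element of `B(β) ∩ C` yields a point of the braid space. -/
theorem nonempty_braidSpace_of_mem {r : ℕ} {G : Subgroup (GL (Fin r) ℂ)} {B T : Subgroup G}
    {β : BraidMonoid B T} {e : BraidExpression β} {C : ConjClasses G} {h : G}
    (hh : h ∈ cellProduct e) (hC : h ∈ C.carrier) : Nonempty (BraidSpace e C) := by
  obtain ⟨f, rfl, hf⟩ := (mem_cellProduct_iff e h).1 hh
  exact ⟨{
    g := (f 0)⁻¹ * f (Fin.last e.n)
    -- Translating by `(f 0)⁻¹` makes the chain start at the base flag `B`, which `h` sends to `hB`,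
    -- the last flag.
    F := fun i => QuotientGroup.mk ((f 0)⁻¹ * f i)
    mem := hC
    smul_eq := by simp [MulAction.Quotient.smul_mk]
    relPos := fun i => by
      rw [relPos_mk_iff]
      simpa [mul_assoc] using hf i }⟩

end BraidStacks

theorem mainTheorem2 {r : ℕ} (G : Subgroup (GL (Fin r) ℂ)) (hG : BraidStacks.IsAlmostSimple G)
    (B T : Subgroup G) (hB : BraidStacks.IsBorel B) (hT : BraidStacks.IsMaximalTorus T)
    (hTB : T ≤ B) (β : BraidStacks.BraidMonoid B T) (e : BraidStacks.BraidExpression β)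
    (hn : 0 < e.n) (C : ConjClasses G) :
    Nonempty (BraidStacks.BraidStack e C) ↔
      (BraidStacks.cellProduct e ∩ C.carrier).Nonempty := by
  -- The objects of the quotient groupoid are the points of the braid space.
  rw [← (CategoryTheory.ActionCategory.objEquiv G (BraidStacks.BraidSpace e C)).nonempty_congr]
  constructor
  · rintro ⟨p⟩
    obtain ⟨a, ha⟩ := p.exists_conj_mem_cellProduct hn
    refine ⟨_, ha, ?_⟩
    have hC := p.mem
    rw [ConjClasses.mem_carrier_iff_mk_eq] at hC ⊢
    refine (ConjClasses.mk_eq_mk_iff_isConj.2 ?_).trans hC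
    exact (isConj_iff.2 ⟨a⁻¹, by rw [inv_inv]⟩).symm
  · rintro ⟨h, hh, hC⟩
    exact BraidStacks.nonempty_braidSpace_of_mem hh hC
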